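/- Consider the sum network creation game with a finite set of players $V$, $|V|=n$, and a real price per link $\alpha>0$: a strategy vector is $s=(s_u)_{u\in V}$ with $s_u\subseteq V\setminus\{u\}$ (the nodes to which $u$ buys a link), the communication network $G_s$ is the undirected graph on $V$ in which $uv$ is an edge iff $v\in s_u$ or $u\in s_v$, and the cost of player $u$ is $c_u(s)=\alpha|s_u|+\sum_{v\neq u}d_{G_s}(u,v)$, where $d_{G_s}(u,v)=\infty$ if $u,v$ are not connected. The vector $s$ is a Nash equilibrium if $c_u(s)\le c_u(s')$ for every player $u$ and every strategy vector $s'$ that differs from $s$ only in the strategy of $u$. A connected graph is biconnected if it has no cut vertex; a biconnected component of a graph is a maximal biconnected subgraph, and it is non-trivial if it has at least three nodes. For a subgraph $H$ of $G_s$ the average directed degree is $\deg^+(H)=\frac{1}{|V(H)|}\sum_{v\in V(H)}|\{u\in V(H): u\in s_v\}|$. Proposition. Let $\alpha>0$, let $s$ be a Nash equilibrium and let $H$ be a non-trivial biconnected component of $G=G_s$. If $\operatorname{diam}(H)\ge 37$, then $$\deg^+(H)\ \ge\ 1+\frac{1}{221}.$$ -/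

import Mathlib

open scoped ENNReal

namespace NetworkCreation

/-- A strategy vector of the network creation game on the set of players `V`: the strategy
`s.links u` of the player `u` is the set of players to which `u` buys a link. -/
structure StrategyVector (V : Type*) where
  links : V → Finset V
  not_mem_self : ∀ u, u ∉ links u

/-- The communication network `G_s`, as an undirected graph. -/
def StrategyVector.graph {V : Type*} (s : StrategyVector V) : SimpleGraph V where
  Adj u v := v ∈ s.links u ∨ u ∈ s.links v
  symm := ⟨fun _ _ h => h.symm⟩
  loopless := ⟨fun u h => h.elim (s.not_mem_self u) (s.not_mem_self u)⟩

/-- The cost `α |s_u| + ∑_{v ≠ u} d(u, v)` of the player `u`, with values in `[0, ∞]`; it is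
infinite when some player cannot be reached from `u` (the term `v = u` of the sum is zero). -/
noncomputable def cost {V : Type*} [Fintype V] (α : ℝ) (s : StrategyVector V) (u : V) : ℝ≥0∞ :=
  ENNReal.ofReal α * ((s.links u).card : ℝ≥0∞) + ∑ v : V, (s.graph.edist u v : ℝ≥0∞)

/-- `s` is a Nash equilibrium: no player can lower his cost by changing only his own strategy. -/
def IsNashEquilibrium {V : Type*} [Fintype V] (α : ℝ) (s : StrategyVector V) : Prop :=
  ∀ (u : V) (s' : StrategyVector V), (∀ v, v ≠ u → s'.links v = s.links v) →
    cost α s u ≤ cost α s' u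

/-- A cut vertex: its removal increases the number of connected components. -/
def IsCutVertex {W : Type*} (G : SimpleGraph W) (v : W) : Prop :=
  ENat.card G.ConnectedComponent < ENat.card (G.induce {w | w ≠ v}).ConnectedComponent

/-- A biconnected graph: connected (in particular non-empty) and without cut vertices. -/
def IsBiconnected {W : Type*} (G : SimpleGraph W) : Prop :=
  G.Connected ∧ ∀ v, ¬ IsCutVertex G v

/-- A biconnected component of `G`: a maximal biconnected subgraph of `G`. -/
def IsBiconnectedComponent {V : Type*} (G : SimpleGraph V) (H : G.Subgraph) : Prop :=
  Maximal (fun K : G.Subgraph => IsBiconnected K.coe) H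

/-- A biconnected component is non-trivial if it has at least three nodes (that is, it is neither
an isolated node nor a bridge). -/
def IsNontrivialBiconnectedComponent {V : Type*} (G : SimpleGraph V) (H : G.Subgraph) : Prop :=
  IsBiconnectedComponent G H ∧ 3 ≤ H.verts.encard

/-- The directed degree `deg⁺_H(v)`: the number of nodes of `H` to which `v` has bought a link. -/
noncomputable def outDegree {V : Type*} (s : StrategyVector V) (H : s.graph.Subgraph) (v : V) : ℕ :=
  {u : V | u ∈ H.verts ∧ u ∈ s.links v}.ncard

open Classical in
/-- The average directed degree `deg⁺(H) = (∑_{v ∈ V(H)} deg⁺_H(v)) / |V(H)|`. -/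
noncomputable def avgOutDegree {V : Type*} [Fintype V] (s : StrategyVector V)
    (H : s.graph.Subgraph) : ℝ :=
  (∑ v : V with v ∈ H.verts, (outDegree s H v : ℝ)) / (H.verts.ncard : ℝ)

end NetworkCreation

namespace NetworkCreation

open SimpleGraph

/-! ### Biconnected components -/

/-! A biconnected component `H` contains every path between two of its vertices
(`IsBiconnectedComponent.pathConvex`). Hence each player is attached to `H` through a single gate,
and the sizes of the resulting branches act as weights on the vertices of `H`.

On a shortest path whose inner vertices have degree two in `H`, three deviations constrain the
weights. Moving a bought link one vertex further shows that its endpoint weighs at least as much as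
all later path vertices together (`sum_card_branch_le`). Deleting a link gives `α ≤ 4 D w`, with `w`
the weight of its endpoint and `D` a bound for the distances from the buyer within `H`, because
biconnectedness supplies a detour of length at most `2 D + 1` (`le_mul_card_branch`). Buying a link
from `y` to `x` gives `(d(y, x) - 1) w(x) ≤ α` (`mul_card_branch_le`). On a path of length 19 the
weights decay so fast that the last two bounds contradict each other (`IsTwoPath.false`).

Since the diameter is at least 37, a shortest path of length 19 starts at every vertex, so every
vertex is within distance 18 of one of degree at least three. Counting by distance to such vertices
bounds `|H|` by `55` times the total excess of the degrees over two, which forces the average degree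
above two. -/

theorem reachable_iff_of_embedding {W V : Type*} {K : SimpleGraph W} {G : SimpleGraph V}
    (f : W → V) (hf : Function.Injective f) (hadj : ∀ a b, K.Adj a b ↔ G.Adj (f a) (f b))
    (hrange : ∀ a c, G.Adj (f a) c → c ∈ Set.range f) (a b : W) :
    K.Reachable a b ↔ G.Reachable (f a) (f b) := by
  constructor
  · rintro ⟨p⟩
    induction p with
    | nil => exact Reachable.refl _
    | cons h _ ih => exact ((hadj _ _).1 h).reachable.trans ih
  · rintro ⟨p⟩
    suffices ∀ x y (_ : G.Walk x y) (a b : W), f a = x → f b = y → K.Reachable a b from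
      this _ _ p a b rfl rfl
    intro x y p
    induction p with
    | nil => rintro a b rfl hb; rw [hf hb]
    | cons h _ ih =>
      rintro a b rfl hb
      obtain ⟨c, rfl⟩ := hrange _ _ h
      exact ((hadj _ _).2 h).reachable.trans (ih c b rfl hb)

theorem isCutVertex_iff {W : Type*} {G : SimpleGraph W} (hG : G.Connected) (v : W) :
    IsCutVertex G v ↔ ¬ (G.induce {w | w ≠ v}).Preconnected := by
  have := hG.preconnected.subsingleton_connectedComponent
  obtain ⟨x⟩ := hG.nonempty
  have h1 : ENat.card G.ConnectedComponent = 1 :=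
    ENat.card_eq_one_iff_unique.2 ⟨⟨⟨G.connectedComponentMk x⟩, fun _ => Subsingleton.elim _ _⟩⟩
  rw [IsCutVertex, h1, ← not_le, not_iff_not, ENat.card_le_one_iff_subsingleton]
  constructor
  · exact fun h a b => ConnectedComponent.exact (h.elim _ _)
  · exact fun h => h.subsingleton_connectedComponent

/-- A subgraph is biconnected iff it is non-empty and stays connected when at most one vertex is
deleted. -/
theorem isBiconnected_coe_iff {V : Type*} {G : SimpleGraph V} (K : G.Subgraph) :
    IsBiconnected K.coe ↔ K.verts.Nonempty ∧ ∀ Z : Set V, Z.Subsingleton →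
      ∀ a ∈ K.verts, ∀ b ∈ K.verts, a ∉ Z → b ∉ Z →
        (K.deleteVerts Z).spanningCoe.Reachable a b := by
  have key (a b : K.verts) :
      K.coe.Reachable a b ↔ (K.deleteVerts ∅).spanningCoe.Reachable a b := by
    apply reachable_iff_of_embedding _ Subtype.val_injective
    · simp
    · intro a c h
      simp at h
      simp [K.edge_vert h.symm]
  have key2 (z : K.verts) (a b : {w : K.verts | w ≠ z}) :
      (K.coe.induce {w | w ≠ z}).Reachable a b ↔
        (K.deleteVerts {(z : V)}).spanningCoe.Reachable a b := by
    apply reachable_iff_of_embedding (fun a : {w : K.verts | w ≠ z} => ((a : K.verts) : V))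
      (Subtype.val_injective.comp Subtype.val_injective)
    · rintro ⟨⟨a, ha⟩, ha'⟩ ⟨⟨b, hb⟩, hb'⟩
      have h1 : a ≠ z := fun h => ha' (Subtype.ext h)
      have h2 : b ≠ z := fun h => hb' (Subtype.ext h)
      simp [ha, hb, h1, h2]
    · rintro ⟨⟨a, ha⟩, ha'⟩ c h
      simp only [Subgraph.spanningCoe_adj, Subgraph.deleteVerts_adj] at h
      exact ⟨⟨⟨c, h.2.2.1⟩, fun h' => h.2.2.2.1 (congrArg Subtype.val h')⟩, rfl⟩
  constructor
  · rintro ⟨hc, hcut⟩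
    obtain ⟨⟨x, hx⟩⟩ := hc.nonempty
    have h0 : ∀ a ∈ K.verts, ∀ b ∈ K.verts, (K.deleteVerts ∅).spanningCoe.Reachable a b :=
      fun a ha b hb => (key ⟨a, ha⟩ ⟨b, hb⟩).1 (hc.preconnected _ _)
    refine ⟨⟨x, hx⟩, fun Z hZ a ha b hb haZ hbZ => ?_⟩
    obtain rfl | ⟨z, rfl⟩ := hZ.eq_empty_or_singleton
    · exact h0 a ha b hb
    · by_cases hz : z ∈ K.verts
      · have h := hcut ⟨z, hz⟩
        rw [isCutVertex_iff hc, not_not] at h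
        exact (key2 ⟨z, hz⟩ ⟨⟨a, ha⟩, fun h' => haZ (congrArg Subtype.val h')⟩
          ⟨⟨b, hb⟩, fun h' => hbZ (congrArg Subtype.val h')⟩).1 (h _ _)
      · refine (h0 a ha b hb).mono ?_
        intro c d h
        simp only [Subgraph.spanningCoe_adj, Subgraph.deleteVerts_adj, Set.mem_empty_iff_false,
          not_false_eq_true, true_and] at h ⊢
        exact ⟨h.1, fun e => hz (e ▸ h.1), h.2.1, fun e => hz (e ▸ h.2.1), h.2.2⟩
  · rintro ⟨⟨x, hx⟩, h⟩
    have hc : K.coe.Connected :=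
      { preconnected := fun a b => (key a b).2
          (h ∅ Set.subsingleton_empty a a.2 b b.2 (Set.notMem_empty _) (Set.notMem_empty _))
        nonempty := ⟨⟨x, hx⟩⟩ }
    refine ⟨hc, fun z => ?_⟩
    rw [isCutVertex_iff hc, not_not]
    exact fun a b => (key2 z a b).2 (h {(z : V)} Set.subsingleton_singleton _ a.1.2 _ b.1.2
      (fun h' => a.2 (Subtype.ext h')) (fun h' => b.2 (Subtype.ext h')))

theorem reachable_induce_deleteVerts {V : Type*} {G : SimpleGraph V} {S Z : Set V} {a b : V}
    (p : G.Walk a b) (hp : ∀ x ∈ p.support, x ∈ S ∧ x ∉ Z) :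
    (((⊤ : G.Subgraph).induce S).deleteVerts Z).spanningCoe.Reachable a b := by
  induction p with
  | nil => exact Reachable.refl _
  | @cons a c b h p ih =>
    have hc := hp c (by simp)
    have ha := hp a (by simp)
    refine Reachable.trans (Adj.reachable ?_) (ih fun x hx => hp x (by simp [hx]))
    simp [ha, hc, h]

/-- A biconnected component absorbs every path between two of its vertices. -/
theorem IsBiconnectedComponent.induce_le {V : Type*} {G : SimpleGraph V} {H : G.Subgraph}
    (hH : IsBiconnectedComponent G H) {u v : V} (hu : u ∈ H.verts) (hv : v ∈ H.verts)
    (p : G.Walk u v) (hp : p.IsPath) :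
    (⊤ : G.Subgraph).induce (H.verts ∪ {x | x ∈ p.support}) ≤ H := by
  classical
  set S : Set V := H.verts ∪ {x | x ∈ p.support} with hS
  obtain ⟨-, hr⟩ := (isBiconnected_coe_iff H).1 hH.prop
  have hle : H ≤ (⊤ : G.Subgraph).induce S := by
    refine ⟨Set.subset_union_left, fun a b hab => ?_⟩
    simpa [hS, H.edge_vert hab, H.edge_vert hab.symm] using hab.adj_sub
  refine hH.le_of_ge ((isBiconnected_coe_iff _).2 ⟨⟨u, Or.inl hu⟩, ?_⟩) hle
  intro Z hZ
  have hH' : ∀ a ∈ H.verts, ∀ b ∈ H.verts, a ∉ Z → b ∉ Z →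
      (((⊤ : G.Subgraph).induce S).deleteVerts Z).spanningCoe.Reachable a b := by
    intro a ha b hb haZ hbZ
    refine (hr Z hZ a ha b hb haZ hbZ).mono ?_
    intro c d h
    simp only [Subgraph.spanningCoe_adj, Subgraph.deleteVerts_adj] at h ⊢
    exact ⟨hle.1 h.1, h.2.1, hle.1 h.2.2.1, h.2.2.2.1, hle.2 h.2.2.2.2⟩
  -- At most one vertex is deleted and the path visits it at most once. So from any surviving path
  -- vertex one of the two halves of the path still leads to an end in `H`.
  have hto : ∀ a ∈ S, a ∉ Z → ∃ b ∈ H.verts, b ∉ Z ∧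
      (((⊤ : G.Subgraph).induce S).deleteVerts Z).spanningCoe.Reachable a b := by
    rintro a (ha | ha) haZ
    · exact ⟨a, ha, haZ, Reachable.refl _⟩
    by_cases h : ∃ z ∈ Z, z ∈ (p.takeUntil a ha).support
    · obtain ⟨z, hz, hzp⟩ := h
      have hdrop : ∀ x ∈ (p.dropUntil a ha).support, x ∉ Z := by
        intro x hx hxZ
        obtain rfl := hZ hz hxZ
        have hnd := hp.support_nodup
        rw [← p.take_spec ha, Walk.support_append, List.nodup_append] at hnd
        rw [← Walk.cons_tail_support, List.mem_cons] at hx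
        obtain rfl | hx := hx
        · exact haZ hz
        · exact hnd.2.2 _ hzp _ hx rfl
      exact ⟨v, hv, hdrop v (Walk.end_mem_support _), reachable_induce_deleteVerts
        (p.dropUntil a ha) fun x hx => ⟨Or.inr (p.support_dropUntil_subset_support ha hx), hdrop x hx⟩⟩
    · push Not at h
      have htake : ∀ x ∈ (p.takeUntil a ha).support, x ∉ Z := fun x hx hxZ => h x hxZ hx
      exact ⟨u, hu, htake u (Walk.start_mem_support _), (reachable_induce_deleteVerts
        (p.takeUntil a ha) fun x hx =>
          ⟨Or.inr (p.support_takeUntil_subset_support ha hx), htake x hx⟩).symm⟩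
  intro a ha b hb haZ hbZ
  obtain ⟨a', ha', ha'Z, hra⟩ := hto a ha haZ
  obtain ⟨b', hb', hb'Z, hrb⟩ := hto b hb hbZ
  exact (hra.trans (hH' a' ha' b' hb' ha'Z hb'Z)).trans hrb.symm

/-- A set of vertices is path convex if it contains every path between two of its members. -/
def PathConvex {V : Type*} (G : SimpleGraph V) (B : Set V) : Prop :=
  ∀ ⦃u v : V⦄, u ∈ B → v ∈ B → ∀ p : G.Walk u v, p.IsPath → ∀ x ∈ p.support, x ∈ B

theorem IsBiconnectedComponent.pathConvex {V : Type*} {G : SimpleGraph V} {H : G.Subgraph}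
    (hH : IsBiconnectedComponent G H) : PathConvex G H.verts :=
  fun _ _ hu hv p hp _ hx => (hH.induce_le hu hv p hp).1 (Or.inr hx)

theorem IsBiconnectedComponent.adj_of_mem {V : Type*} {G : SimpleGraph V} {H : G.Subgraph}
    (hH : IsBiconnectedComponent G H) {u v : V} (hu : u ∈ H.verts) (hv : v ∈ H.verts)
    (h : G.Adj u v) : H.Adj u v :=
  (hH.induce_le hu hv (Walk.cons h Walk.nil) (by simp [h.ne])).2 (by simp [hu, hv, h])

/-- Every set of vertices that separates two vertices of a biconnected component is left by an edge
of the component that avoids a given third vertex. -/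
theorem IsBiconnectedComponent.exists_crossing {V : Type*} {G : SimpleGraph V} {H : G.Subgraph}
    (hH : IsBiconnectedComponent G H) {z a b : V} (ha : a ∈ H.verts) (hb : b ∈ H.verts)
    (haz : a ≠ z) (hbz : b ≠ z) (T : Set V) (haT : a ∈ T) (hbT : b ∉ T) :
    ∃ t ∈ H.verts, ∃ u ∈ H.verts, t ∈ T ∧ u ∉ T ∧ t ≠ z ∧ u ≠ z ∧ G.Adj t u := by
  obtain ⟨p⟩ := ((isBiconnected_coe_iff H).1 hH.prop).2 {z} Set.subsingleton_singleton a ha b hb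
    haz hbz
  obtain ⟨d, -, h1, h2⟩ := p.exists_boundary_dart T haT hbT
  have h := d.adj
  simp only [Subgraph.spanningCoe_adj, Subgraph.deleteVerts_adj, Set.mem_singleton_iff] at h
  exact ⟨_, h.1, _, h.2.2.1, h1, h2, h.2.1, h.2.2.2.1, h.2.2.2.2.adj_sub⟩

end NetworkCreation

namespace NetworkCreation

open SimpleGraph

/-! ### Distances to a path convex set -/

theorem dist_add_dist_le_length {V : Type*} {G : SimpleGraph V} {a b x : V} (p : G.Walk a b)
    (hx : x ∈ p.support) : G.dist a x + G.dist x b ≤ p.length := by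
  classical
  calc G.dist a x + G.dist x b ≤ (p.takeUntil x hx).length + (p.dropUntil x hx).length :=
        add_le_add (dist_le _) (dist_le _)
    _ = p.length := by rw [← Walk.length_append, Walk.take_spec]

theorem exists_adj_dist_add_one {V : Type*} {G : SimpleGraph V} (hG : G.Connected) {x v : V}
    (h : x ≠ v) : ∃ a, G.Adj x a ∧ G.dist a v + 1 = G.dist x v := by
  obtain ⟨p, hp⟩ := hG.exists_walk_length_eq_dist x v
  cases p with
  | nil => exact absurd rfl h
  | @cons _ a _ hxa q =>
    refine ⟨a, hxa, le_antisymm ?_ ?_⟩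
    · rw [← hp, Walk.length_cons]
      exact Nat.succ_le_succ (dist_le q)
    · have := hG.dist_triangle (u := x) (v := a) (w := v)
      rw [dist_eq_one_iff_adj.2 hxa] at this
      omega

/-- A shortest path between members of `B` stays in `B`, so its second vertex serves. -/
theorem PathConvex.exists_adj_dist_add_one {V : Type*} {G : SimpleGraph V} {B : Set V}
    (hB : PathConvex G B) (hG : G.Connected) {x v : V} (hx : x ∈ B) (hv : v ∈ B) (h : x ≠ v) :
    ∃ a ∈ B, G.Adj x a ∧ G.dist a v + 1 = G.dist x v := by
  obtain ⟨p, hpath, hp⟩ := hG.exists_path_of_dist x v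
  cases p with
  | nil => exact absurd rfl h
  | @cons _ a _ hxa q =>
    refine ⟨a, hB hx hv _ hpath a (by simp), hxa, le_antisymm ?_ ?_⟩
    · rw [← hp, Walk.length_cons]
      exact Nat.succ_le_succ (dist_le q)
    · have := hG.dist_triangle (u := x) (v := a) (w := v)
      rw [dist_eq_one_iff_adj.2 hxa] at this
      omega

/-- Every vertex has a gate in a path convex set. -/
theorem PathConvex.exists_gate {V : Type*} {G : SimpleGraph V} {B : Set V}
    (hB : PathConvex G B) (hG : G.Connected) (hne : B.Nonempty) (v : V) :
    ∃ p ∈ B, ∀ y ∈ B, G.dist y v = G.dist y p + G.dist p v := by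
  classical
  -- The gate is a member of `B` nearest to `v`.
  obtain ⟨p, hpB, hmin⟩ := (measure fun x => G.dist x v).wf.has_min B hne
  have hmin : ∀ x ∈ B, G.dist p v ≤ G.dist x v := fun x hx => not_lt.1 (hmin x hx)
  refine ⟨p, hpB, fun y hy => le_antisymm hG.dist_triangle ?_⟩
  obtain ⟨q, hq⟩ := hG.exists_walk_length_eq_dist p v
  obtain ⟨g, hg⟩ := hG.exists_walk_length_eq_dist y v
  by_cases hpg : p ∈ g.support
  · exact hg ▸ dist_add_dist_le_length g hpg
  exfalso
  -- Shortcutting the walk from `p` via `v` to `y` gives a path, whose second vertex `c` lies in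
  -- `B`. Its first edge comes from `q`, and then `c` is nearer to `v` than `p`, or from `g`, which
  -- avoids `p`.
  have hbyp := (q.append g.reverse).bypass_isPath
  have hedges := (q.append g.reverse).edges_bypass_subset_edges
  generalize (q.append g.reverse).bypass = r at hbyp hedges
  cases r with
  | nil => exact hpg g.start_mem_support
  | @cons _ c _ hpc r =>
    have hcB : c ∈ B := hB hpB hy _ hbyp c (by simp)
    have he : s(p, c) ∈ (q.append g.reverse).edges := hedges (by simp)
    rw [Walk.edges_append, List.mem_append, Walk.edges_reverse, List.mem_reverse] at he
    obtain he | he := he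
    · have h1 := dist_add_dist_le_length q (Walk.snd_mem_support_of_mem_edges _ he)
      have h2 := hmin c hcB
      rw [dist_eq_one_iff_adj.2 hpc] at h1
      omega
    · exact hpg (Walk.fst_mem_support_of_mem_edges _ he)

open Classical in
/-- The vertices that are attached to the set `B` through its member `x`. -/
noncomputable def branch {V : Type*} [Fintype V] (G : SimpleGraph V) (B : Set V) (x : V) :
    Finset V :=
  {v | ∀ y ∈ B, G.dist y v = G.dist y x + G.dist x v}

theorem mem_branch {V : Type*} [Fintype V] {G : SimpleGraph V} {B : Set V} {x v : V} :
    v ∈ branch G B x ↔ ∀ y ∈ B, G.dist y v = G.dist y x + G.dist x v := by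
  simp [branch]

theorem self_mem_branch {V : Type*} [Fintype V] {G : SimpleGraph V} {B : Set V} {x : V} :
    x ∈ branch G B x := by
  simp [mem_branch]

theorem card_branch_pos {V : Type*} [Fintype V] {G : SimpleGraph V} {B : Set V} {x : V} :
    0 < (branch G B x).card :=
  Finset.card_pos.2 ⟨x, self_mem_branch⟩

theorem disjoint_branch {V : Type*} [Fintype V] {G : SimpleGraph V} (hG : G.Connected)
    {B : Set V} {x y : V} (hx : x ∈ B) (hy : y ∈ B) (hxy : x ≠ y) :
    Disjoint (branch G B x) (branch G B y) := by
  rw [Finset.disjoint_left]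
  intro v hvx hvy
  have h1 := mem_branch.1 hvx y hy
  have h2 := mem_branch.1 hvy x hx
  have h3 := hG.pos_dist_of_ne hxy
  have h4 : G.dist x y = G.dist y x := dist_comm
  omega

/-- Either `x` is the gate of `v`, or a shortest path towards the gate starts inside `B`. This
reduces distance estimates at a vertex of degree two in `B` to its two neighbours there. -/
theorem PathConvex.mem_branch_or_exists_adj {V : Type*} [Fintype V] {G : SimpleGraph V} {B : Set V}
    (hB : PathConvex G B) (hG : G.Connected) {x : V} (hx : x ∈ B) (v : V) :
    v ∈ branch G B x ∨ ∃ a ∈ B, G.Adj x a ∧ G.dist a v + 1 = G.dist x v := by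
  obtain ⟨p, hp, hgate⟩ := hB.exists_gate hG ⟨x, hx⟩ v
  obtain rfl | hxp := eq_or_ne x p
  · exact Or.inl (mem_branch.2 hgate)
  · obtain ⟨a, ha, hxa, had⟩ := hB.exists_adj_dist_add_one hG hx hp hxp
    refine Or.inr ⟨a, ha, hxa, ?_⟩
    rw [hgate a ha, hgate x hx, ← had]
    ring

end NetworkCreation

namespace NetworkCreation

open SimpleGraph

/-! ### Deviations from a Nash equilibrium -/

open Classical in
/-- The strategy vector in which the strategy of `u` is replaced by `t`. -/
noncomputable def StrategyVector.update {V : Type*} (s : StrategyVector V) (u : V) (t : Finset V)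
    (ht : u ∉ t) : StrategyVector V where
  links := Function.update s.links u t
  not_mem_self v := by
    obtain rfl | h := eq_or_ne v u
    · simpa using ht
    · simpa [h] using s.not_mem_self v

theorem StrategyVector.update_links_of_ne {V : Type*} (s : StrategyVector V) {u : V} {t : Finset V}
    (ht : u ∉ t) {v : V} (hv : v ≠ u) : (s.update u t ht).links v = s.links v := by
  simp [StrategyVector.update, hv]

theorem StrategyVector.update_links_self {V : Type*} (s : StrategyVector V) {u : V} {t : Finset V}
    (ht : u ∉ t) : (s.update u t ht).links u = t := by
  simp [StrategyVector.update]

theorem StrategyVector.update_adj_of_ne {V : Type*} (s : StrategyVector V) {u : V} {t : Finset V}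
    (ht : u ∉ t) {a b : V} (ha : a ≠ u) (hb : b ≠ u) (h : s.graph.Adj a b) :
    (s.update u t ht).graph.Adj a b := by
  simpa [StrategyVector.graph, s.update_links_of_ne ht ha, s.update_links_of_ne ht hb] using h

theorem StrategyVector.update_adj_of_mem {V : Type*} (s : StrategyVector V) {u : V} {t : Finset V}
    (ht : u ∉ t) {a : V} (ha : a ∈ t) : (s.update u t ht).graph.Adj u a :=
  Or.inl (by rwa [s.update_links_self])

theorem StrategyVector.update_adj_of_adj {V : Type*} (s : StrategyVector V) {u : V} {t : Finset V}
    (ht : u ∉ t) {a : V} (h : s.graph.Adj u a) (ha : a ∈ s.links u → a ∈ t) :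
    (s.update u t ht).graph.Adj u a := by
  obtain h' | h' := h
  · exact s.update_adj_of_mem ht (ha h')
  · refine Or.inr ?_
    rwa [s.update_links_of_ne ht]
    rintro rfl
    exact s.not_mem_self _ h'

/-- Buying links to all other players has finite cost, so no equilibrium cost is infinite. -/
theorem IsNashEquilibrium.connected {V : Type*} [Fintype V] [Nonempty V] {α : ℝ}
    {s : StrategyVector V} (hs : IsNashEquilibrium α s) : s.graph.Connected := by
  classical
  refine { preconnected := fun u v => ?_ }
  have ht : u ∉ Finset.univ.erase u := by simp
  have h := hs u (s.update u _ ht) fun v hv => s.update_links_of_ne ht hv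
  have hfin : cost α (s.update u _ ht) u < ⊤ := by
    refine ENNReal.add_lt_top.2 ⟨ENNReal.mul_lt_top ENNReal.ofReal_lt_top (by simp), ?_⟩
    refine ENNReal.sum_lt_top.2 fun w _ => ?_
    rw [ENat.toENNReal_lt_top, lt_top_iff_ne_top, edist_ne_top_iff_reachable]
    obtain rfl | hw := eq_or_ne w u
    · exact Reachable.refl _
    · exact (s.update_adj_of_mem ht (by simpa using hw)).reachable
  have h2 := (ENNReal.add_lt_top.1 (h.trans_lt hfin)).2
  have h3 := ENNReal.sum_lt_top.1 h2 v (Finset.mem_univ v)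
  rw [ENat.toENNReal_lt_top, lt_top_iff_ne_top, edist_ne_top_iff_reachable] at h3
  exact h3

/-- Turns the equilibrium condition into a real inequality: any finite upper bound `f` for the
distances after the deviation suffices. -/
theorem IsNashEquilibrium.le_of_edist_le {V : Type*} [Fintype V] {α : ℝ} (hα : 0 < α)
    {s : StrategyVector V} (hs : IsNashEquilibrium α s) (hG : s.graph.Connected) {u : V}
    {t : Finset V} (ht : u ∉ t) (f : V → ℕ)
    (hf : ∀ v, (s.update u t ht).graph.edist u v ≤ f v) :
    α * (s.links u).card + ∑ v, (s.graph.dist u v : ℝ) ≤ α * t.card + ∑ v, (f v : ℝ) := by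
  have h := hs u (s.update u t ht) fun v hv => s.update_links_of_ne ht hv
  have hl : cost α s u =
      ENNReal.ofReal (α * (s.links u).card + ∑ v, (s.graph.dist u v : ℝ)) := by
    rw [ENNReal.ofReal_add (by positivity) (by positivity), ENNReal.ofReal_mul hα.le,
      ENNReal.ofReal_natCast, ENNReal.ofReal_sum_of_nonneg (by simp), cost]
    congr 1
    refine Finset.sum_congr rfl fun v _ => ?_
    rw [← (hG u v).coe_dist_eq_edist, ENNReal.ofReal_natCast]
    rfl
  have hr : cost α (s.update u t ht) u ≤
      ENNReal.ofReal (α * t.card + ∑ v, (f v : ℝ)) := by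
    rw [ENNReal.ofReal_add (by positivity) (by positivity), ENNReal.ofReal_mul hα.le,
      ENNReal.ofReal_natCast, ENNReal.ofReal_sum_of_nonneg (by simp), cost,
      s.update_links_self]
    gcongr with v
    rw [ENNReal.ofReal_natCast]
    exact ENat.toENNReal_le.2 (hf v)
  rw [hl] at h
  exact (ENNReal.ofReal_le_ofReal_iff (by positivity)).1 (h.trans hr)

theorem edist_le_one_add {V : Type*} {G : SimpleGraph V} {u a v : V} {n : ℕ} (h : G.Adj u a)
    (ha : G.edist a v ≤ n) : G.edist u v ≤ (n + 1 : ℕ) := by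
  have h1 := G.edist_triangle (u := u) (v := a) (w := v)
  rw [edist_eq_one_iff_adj.2 h] at h1
  refine h1.trans ?_
  rw [add_comm]
  push_cast
  gcongr

/-- A vertex that is not further from `v` than `u` keeps its distance to `v` when the edges at `u`
are changed. -/
theorem edist_le_dist_of_avoid {V : Type*} {G G' : SimpleGraph V} (hG : G.Connected) {u v : V}
    (h : ∀ a b, a ≠ u → b ≠ u → G.Adj a b → G'.Adj a b) {a : V} (ha : a ≠ u)
    (hd : G.dist a v ≤ G.dist u v) : G'.edist a v ≤ G.dist a v := by
  induction hn : G.dist a v generalizing a with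
  | zero =>
    rw [hG.dist_eq_zero_iff] at hn
    simp [hn]
  | succ n ih =>
    have hav : a ≠ v := by
      rintro rfl
      simp at hn
    obtain ⟨b, hab, hb⟩ := exists_adj_dist_add_one hG hav
    -- The next vertex of a shortest path is strictly closer to `v` than `a`, hence than `u`.
    have hbu : b ≠ u := by
      rintro rfl
      omega
    exact edist_le_one_add (h a b ha hbu hab) (ih hbu (by omega) (by omega))

open Classical in
/-- The vertices towards which every shortest path from `u` starts with the edge to `z`, when
`p` and `z` are the only neighbours of `u` that matter. -/
noncomputable def farSide {V : Type*} [Fintype V] (G : SimpleGraph V) (p u z : V) : Finset V :=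
  {v | G.dist z v + 1 = G.dist u v ∧ G.dist p v + 1 ≠ G.dist u v}

theorem mem_farSide {V : Type*} [Fintype V] {G : SimpleGraph V} {p u z v : V} :
    v ∈ farSide G p u z ↔ G.dist z v + 1 = G.dist u v ∧ G.dist p v + 1 ≠ G.dist u v := by
  simp [farSide]

/-- Vertices that are not on the far side keep their distance when the edge to `z` is given up. -/
theorem StrategyVector.update_edist_le_of_notMem_farSide {V : Type*} [Fintype V]
    {s : StrategyVector V} (hG : s.graph.Connected) {B : Set V} (hB : PathConvex s.graph B)
    {p u z : V} (hu : u ∈ B) (hz : z ∈ B) (huz : s.graph.Adj u z) (hup : s.graph.Adj u p)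
    (hpz : p ≠ z) (hnbr : ∀ a ∈ B, s.graph.Adj u a → a = p ∨ a = z) {t : Finset V} (ht : u ∉ t)
    (hsub : ∀ a ∈ s.links u, a ≠ z → a ∈ t) {v : V} (hv : v ∉ farSide s.graph p u z) :
    (s.update u t ht).graph.edist u v ≤ s.graph.dist u v := by
  obtain rfl | huv := eq_or_ne u v
  · simp
  suffices ∃ a, a ≠ z ∧ s.graph.Adj u a ∧ s.graph.dist a v + 1 = s.graph.dist u v by
    obtain ⟨a, haz, hua, ha⟩ := this
    rw [← ha]
    exact edist_le_one_add (s.update_adj_of_adj ht hua fun h => hsub a h haz)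
      (edist_le_dist_of_avoid hG (fun a b h1 h2 h => s.update_adj_of_ne ht h1 h2 h) hua.ne'
        (by omega))
  obtain hb | ⟨a, ha, hua, had⟩ := hB.mem_branch_or_exists_adj hG hu v
  · obtain ⟨a, hua, ha⟩ := exists_adj_dist_add_one hG huv
    refine ⟨a, ?_, hua, ha⟩
    rintro rfl
    have := mem_branch.1 hb a hz
    omega
  · obtain rfl | rfl := hnbr a ha hua
    · exact ⟨a, hpz, hua, had⟩
    · refine ⟨p, hpz, hup, ?_⟩
      rw [mem_farSide, not_and_not_right] at hv
      exact hv had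

theorem card_le_two_mul_of_sdiff_le {V : Type*} [DecidableEq V] {A S : Finset V}
    (h : (A \ S).card ≤ S.card) : A.card ≤ 2 * S.card := by
  have h1 := Finset.card_sdiff_add_card_inter A S
  have h2 := Finset.card_le_card (Finset.inter_subset_right : A ∩ S ⊆ S)
  omega

open Classical in
/-- The deviation in which `u` replaces the link to `z` by a link to the next vertex `q`. -/
theorem IsNashEquilibrium.card_farSide_sdiff_le {V : Type*} [Fintype V] {α : ℝ} (hα : 0 < α)
    {s : StrategyVector V} (hs : IsNashEquilibrium α s) (hG : s.graph.Connected) {B : Set V}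
    (hB : PathConvex s.graph B) {p u z q : V} (hu : u ∈ B) (hz : z ∈ B) (hbuy : z ∈ s.links u)
    (hup : s.graph.Adj u p) (hpz : p ≠ z) (hzq : s.graph.Adj z q) (hqu : q ≠ u)
    (hnbru : ∀ a ∈ B, s.graph.Adj u a → a = p ∨ a = z)
    (hnbrz : ∀ a ∈ B, s.graph.Adj z a → a = u ∨ a = q) :
    (farSide s.graph p u z \ branch s.graph B z).card ≤ (branch s.graph B z).card := by
  set A := farSide s.graph p u z
  set S := branch s.graph B z
  have huz : s.graph.Adj u z := Or.inl hbuy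
  have ht : u ∉ insert q ((s.links u).erase z) := by
    simp [hqu.symm, s.not_mem_self]
  -- On the far side, the branch at `z` gets one step further away and everything else, being
  -- reached through `q`, one step closer. The truncated subtraction is harmless there, since the
  -- old distance is positive.
  let f : V → ℕ := fun v =>
    if v ∈ A then if v ∈ S then s.graph.dist u v + 1 else s.graph.dist u v - 1
    else s.graph.dist u v
  have hadj : ∀ a b, a ≠ u → b ≠ u → s.graph.Adj a b → (s.update u _ ht).graph.Adj a b :=
    fun a b h1 h2 h => s.update_adj_of_ne ht h1 h2 h
  have huq : (s.update u _ ht).graph.Adj u q := s.update_adj_of_mem ht (by simp)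
  have hf : ∀ v, (s.update u _ ht).graph.edist u v ≤ f v := by
    intro v
    simp only [f]
    split_ifs with hA hS
    · have hd := (mem_farSide.1 hA).1
      rw [← hd]
      exact edist_le_one_add huq (edist_le_one_add (hadj q z hqu huz.ne' hzq.symm)
        (edist_le_dist_of_avoid hG hadj huz.ne' (by omega)))
    · have hd := (mem_farSide.1 hA).1
      obtain h | ⟨a, ha, hza, had⟩ := hB.mem_branch_or_exists_adj hG hz v
      · exact absurd h hS
      obtain rfl | rfl := hnbrz a ha hza
      · omega
      · have : s.graph.dist u v - 1 = s.graph.dist a v + 1 := by omega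
        rw [this]
        exact edist_le_one_add huq (edist_le_dist_of_avoid hG hadj hqu (by omega))
    · exact StrategyVector.update_edist_le_of_notMem_farSide hG hB hu hz huz hup hpz hnbru ht
        (fun a ha haz => by simp [ha, haz]) hA
  have h := hs.le_of_edist_le hα hG ht f hf
  have hcard : ((insert q ((s.links u).erase z)).card : ℝ) ≤ (s.links u).card := by
    have h1 := Finset.card_insert_le q ((s.links u).erase z)
    have h2 := Finset.card_erase_add_one hbuy
    exact_mod_cast (by omega)
  have hsum : ∑ v, (s.graph.dist u v : ℝ) ≤ ∑ v, (f v : ℝ) := by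
    nlinarith [mul_le_mul_of_nonneg_left hcard hα.le]
  have hfd : ∀ v, (f v : ℝ) = s.graph.dist u v +
      ((if v ∈ A ∩ S then (1 : ℝ) else 0) - if v ∈ A \ S then (1 : ℝ) else 0) := by
    intro v
    simp only [f, Finset.mem_inter, Finset.mem_sdiff]
    by_cases hA : v ∈ A <;> by_cases hS : v ∈ S <;> simp only [hA, hS, if_true, if_false, true_and,
      false_and, not_true, not_false_iff]
    · push_cast; ring
    · have hd := (mem_farSide.1 hA).1
      rw [← hd]; push_cast; ring_nf
    · simp
    · simp
  simp_rw [hfd, Finset.sum_add_distrib, Finset.sum_sub_distrib] at hsum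
  simp only [Finset.sum_ite_mem, Finset.univ_inter, Finset.sum_const, nsmul_eq_mul, mul_one]
    at hsum
  have h3 : ((A \ S).card : ℝ) ≤ (A ∩ S).card := by linarith
  exact (Nat.cast_le.1 h3).trans (Finset.card_le_card Finset.inter_subset_right)

/-- The deviation in which `u` deletes the link to `z`. -/
theorem IsNashEquilibrium.le_mul_card_farSide {V : Type*} [Fintype V] {α : ℝ} (hα : 0 < α)
    {s : StrategyVector V} (hs : IsNashEquilibrium α s) (hG : s.graph.Connected) {B : Set V}
    (hB : PathConvex s.graph B) {p u z : V} (hu : u ∈ B) (hz : z ∈ B) (hbuy : z ∈ s.links u)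
    (hup : s.graph.Adj u p) (hpz : p ≠ z)
    (hnbru : ∀ a ∈ B, s.graph.Adj u a → a = p ∨ a = z) {m : ℕ}
    (hdetour : ∀ t (ht : u ∉ t), (∀ a ∈ s.links u, a ≠ z → a ∈ t) →
      (s.update u t ht).graph.edist u z ≤ (m + 1 : ℕ)) :
    α ≤ m * (farSide s.graph p u z).card := by
  classical
  set A := farSide s.graph p u z
  have huz : s.graph.Adj u z := Or.inl hbuy
  have ht : u ∉ (s.links u).erase z := by simp [s.not_mem_self]
  have hsub : ∀ a ∈ s.links u, a ≠ z → a ∈ (s.links u).erase z := fun a ha haz => by simp [ha, haz]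
  have hadj : ∀ a b, a ≠ u → b ≠ u → s.graph.Adj a b → (s.update u _ ht).graph.Adj a b :=
    fun a b h1 h2 h => s.update_adj_of_ne ht h1 h2 h
  -- The detour to `z` costs at most `m` more than the deleted link, and only the far side has to
  -- take it.
  let f : V → ℕ := fun v => s.graph.dist u v + if v ∈ A then m else 0
  have hf : ∀ v, (s.update u _ ht).graph.edist u v ≤ f v := by
    intro v
    simp only [f]
    split_ifs with hA
    · have hd := (mem_farSide.1 hA).1
      have h1 := hdetour _ ht hsub
      have h2 := edist_le_dist_of_avoid (v := v) hG hadj huz.ne' (by omega)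
      refine ((s.update u _ ht).graph.edist_triangle (v := z)).trans ((add_le_add h1 h2).trans ?_)
      rw [← hd]
      exact_mod_cast (by omega)
    · exact StrategyVector.update_edist_le_of_notMem_farSide hG hB hu hz huz hup hpz hnbru ht
        hsub hA
  have h := hs.le_of_edist_le hα hG ht f hf
  have hcard : ((s.links u).card : ℝ) = ((s.links u).erase z).card + 1 := by
    exact_mod_cast (Finset.card_erase_add_one hbuy).symm
  simp only [f, Nat.cast_add, Finset.sum_add_distrib, Nat.cast_ite, Finset.sum_ite_mem,
    Finset.univ_inter, Finset.sum_const, nsmul_eq_mul, Nat.cast_zero] at h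
  rw [hcard] at h
  linarith

/-- The deviation in which `y` buys a link to `x`. -/
theorem IsNashEquilibrium.mul_card_branch_le {V : Type*} [Fintype V] {α : ℝ} (hα : 0 < α)
    {s : StrategyVector V} (hs : IsNashEquilibrium α s) (hG : s.graph.Connected) {B : Set V}
    {x y : V} (hy : y ∈ B) (hxy : x ≠ y) :
    ((s.graph.dist y x : ℝ) - 1) * (branch s.graph B x).card ≤ α := by
  classical
  set S := branch s.graph B x
  have ht : y ∉ insert x (s.links y) := by simp [hxy.symm, s.not_mem_self]
  have hle : s.graph ≤ (s.update y _ ht).graph := by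
    intro a b h
    by_cases ha : a = y
    · subst ha
      exact s.update_adj_of_adj ht h fun h => by simp [h]
    · by_cases hb : b = y
      · subst hb
        exact (s.update_adj_of_adj ht h.symm fun h => by simp [h]).symm
      · exact s.update_adj_of_ne ht ha hb h
  have hle' : ∀ a b, (s.update y _ ht).graph.edist a b ≤ s.graph.dist a b := fun a b => by
    rw [(hG a b).coe_dist_eq_edist]
    exact edist_anti hle
  let f : V → ℕ := fun v => if v ∈ S then s.graph.dist x v + 1 else s.graph.dist y v
  have hf : ∀ v, (s.update y _ ht).graph.edist y v ≤ f v := by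
    intro v
    simp only [f]
    split_ifs with hS
    · exact edist_le_one_add (s.update_adj_of_mem ht (by simp)) (hle' x v)
    · exact hle' y v
  have h := hs.le_of_edist_le hα hG ht f hf
  have hfd : ∀ v, (f v : ℝ) = s.graph.dist y v -
      if v ∈ S then (s.graph.dist y x : ℝ) - 1 else 0 := by
    intro v
    simp only [f]
    split_ifs with hS
    · rw [mem_branch.1 hS y hy]; push_cast; ring
    · simp
  have hcard : ((insert x (s.links y)).card : ℝ) ≤ (s.links y).card + 1 := by
    exact_mod_cast Finset.card_insert_le _ _
  simp_rw [hfd, Finset.sum_sub_distrib] at h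
  simp only [Finset.sum_ite_mem, Finset.univ_inter, Finset.sum_const, nsmul_eq_mul] at h
  nlinarith [mul_le_mul_of_nonneg_left hcard hα.le]

end NetworkCreation

namespace NetworkCreation

open SimpleGraph

/-! ### Shortest paths of vertices of degree two -/

/-- `x 0, …, x n` is a shortest path in `G` inside `B` whose inner vertices have no other
neighbours in `B`. -/
structure IsTwoPath {V : Type*} (G : SimpleGraph V) (B : Set V) (n : ℕ) (x : ℕ → V) : Prop where
  mem : ∀ i ≤ n, x i ∈ B
  dist_add : ∀ i j, i ≤ j → j ≤ n → G.dist (x i) (x j) + i = j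
  eq_or_eq : ∀ i, i + 2 ≤ n → ∀ a ∈ B, G.Adj (x (i + 1)) a → a = x i ∨ a = x (i + 2)

namespace IsTwoPath

theorem adj {V : Type*} {G : SimpleGraph V} {B : Set V} {n : ℕ} {x : ℕ → V}
    (hx : IsTwoPath G B n x) {i : ℕ} (hi : i + 1 ≤ n) : G.Adj (x i) (x (i + 1)) := by
  have := hx.dist_add i (i + 1) (by omega) hi
  exact dist_eq_one_iff_adj.1 (by omega)

theorem ne {V : Type*} {G : SimpleGraph V} {B : Set V} {n : ℕ} {x : ℕ → V}
    (hx : IsTwoPath G B n x) {i j : ℕ} (hij : i < j) (hj : j ≤ n) : x i ≠ x j := by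
  intro h
  have := hx.dist_add i j hij.le hj
  rw [h, dist_self] at this
  omega

theorem reverse {V : Type*} {G : SimpleGraph V} {B : Set V} {n : ℕ} {x : ℕ → V}
    (hx : IsTwoPath G B n x) : IsTwoPath G B n fun i => x (n - i) where
  mem i _ := hx.mem _ (by omega)
  dist_add i j hij hj := by
    have := hx.dist_add (n - j) (n - i) (by omega) (by omega)
    rw [dist_comm] at this
    omega
  eq_or_eq i hi a ha h := by
    have e1 : n - (i + 1) = n - (i + 2) + 1 := by omega
    have e2 : n - i = n - (i + 2) + 2 := by omega
    simp only [e1] at h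
    simp only [e2]
    exact (hx.eq_or_eq (n - (i + 2)) (by omega) a ha h).symm

variable {V : Type*} [Fintype V] {α : ℝ} {s : StrategyVector V} {B : Set V} {n : ℕ} {x : ℕ → V}

open Classical in
theorem card_farSide_sdiff_le (hx : IsTwoPath s.graph B n x) (hα : 0 < α)
    (hs : IsNashEquilibrium α s) (hG : s.graph.Connected) (hB : PathConvex s.graph B) {i : ℕ}
    (hi : i + 3 ≤ n) (hbuy : x (i + 2) ∈ s.links (x (i + 1))) :
    (farSide s.graph (x i) (x (i + 1)) (x (i + 2)) \ branch s.graph B (x (i + 2))).card ≤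
      (branch s.graph B (x (i + 2))).card :=
  hs.card_farSide_sdiff_le hα hG hB (hx.mem _ (by omega)) (hx.mem _ (by omega)) hbuy
    (hx.adj (by omega)).symm (hx.ne (by omega) (by omega)) (hx.adj hi)
    (hx.ne (i := i + 1) (by omega) hi).symm (hx.eq_or_eq i (by omega)) (hx.eq_or_eq (i + 1) hi)

theorem sum_card_branch_le (hx : IsTwoPath s.graph B n x) (hα : 0 < α)
    (hs : IsNashEquilibrium α s) (hG : s.graph.Connected) (hB : PathConvex s.graph B) {i : ℕ}
    (hi : i + 3 ≤ n) (hbuy : x (i + 2) ∈ s.links (x (i + 1))) :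
    ∑ j ∈ Finset.Icc (i + 3) n, (branch s.graph B (x j)).card ≤
      (branch s.graph B (x (i + 2))).card := by
  classical
  refine le_trans ?_ (hx.card_farSide_sdiff_le hα hs hG hB hi hbuy)
  rw [← Finset.card_biUnion]
  · refine Finset.card_le_card fun v hv => ?_
    obtain ⟨j, hj, hv⟩ := Finset.mem_biUnion.1 hv
    rw [Finset.mem_Icc] at hj
    have h0 := mem_branch.1 hv _ (hx.mem i (by omega))
    have h1 := mem_branch.1 hv _ (hx.mem (i + 1) (by omega))
    have h2 := mem_branch.1 hv _ (hx.mem (i + 2) (by omega))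
    have d0 := hx.dist_add i j (by omega) hj.2
    have d1 := hx.dist_add (i + 1) j (by omega) hj.2
    have d2 := hx.dist_add (i + 2) j (by omega) hj.2
    refine Finset.mem_sdiff.2 ⟨mem_farSide.2 ⟨by omega, by omega⟩, ?_⟩
    exact Finset.disjoint_left.1 (disjoint_branch hG (hx.mem j hj.2) (hx.mem (i + 2) (by omega))
      (hx.ne (by omega) hj.2).symm) hv
  · intro j hj k hk hjk
    simp only [Finset.coe_Icc, Set.mem_Icc] at hj hk
    refine disjoint_branch hG (hx.mem j hj.2) (hx.mem k hk.2) ?_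
    obtain h | h := lt_or_gt_of_ne hjk
    · exact hx.ne h hk.2
    · exact (hx.ne h hj.2).symm

theorem card_farSide_le (hx : IsTwoPath s.graph B n x) (hα : 0 < α)
    (hs : IsNashEquilibrium α s) (hG : s.graph.Connected) (hB : PathConvex s.graph B) {i : ℕ}
    (hi : i + 3 ≤ n) (hbuy : x (i + 2) ∈ s.links (x (i + 1))) :
    (farSide s.graph (x i) (x (i + 1)) (x (i + 2))).card ≤
      2 * (branch s.graph B (x (i + 2))).card := by
  classical
  exact card_le_two_mul_of_sdiff_le (hx.card_farSide_sdiff_le hα hs hG hB hi hbuy)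

/-- Links that are bought towards each other are adjacent or do not lie on a common path. -/
theorem mem_links_of_mem_links (hx : IsTwoPath s.graph B n x) (hα : 0 < α)
    (hs : IsNashEquilibrium α s) (hG : s.graph.Connected) (hB : PathConvex s.graph B) {i k : ℕ}
    (hik : i + 2 < k) (hk : k + 2 ≤ n) (hbuy : x (i + 2) ∈ s.links (x (i + 1))) :
    x (k + 1) ∈ s.links (x k) := by
  refine (hx.adj (i := k) (by omega)).resolve_right fun hk' => ?_
  have h1 := hx.sum_card_branch_le hα hs hG hB (by omega) hbuy
  have e1 : n - (n - (k + 2) + 2) = k := by omega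
  have e2 : n - (n - (k + 2) + 1) = k + 1 := by omega
  have h2 := hx.reverse.sum_card_branch_le hα hs hG hB (i := n - (k + 2)) (by omega)
    (by simpa only [e1, e2] using hk')
  simp only [e1] at h2
  -- Two links bought towards each other would give `w(k) + w(n) ≤ w(i + 2)` and `w(i + 2) ≤ w(k)`,
  -- which is absurd as `w(n)` is positive.
  have h3 : (branch s.graph B (x k)).card + (branch s.graph B (x n)).card ≤
      ∑ j ∈ Finset.Icc (i + 3) n, (branch s.graph B (x j)).card := by
    rw [← Finset.sum_pair (f := fun j => (branch s.graph B (x j)).card) (by omega : k ≠ n)]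
    refine Finset.sum_le_sum_of_subset fun j hj => ?_
    simp only [Finset.mem_insert, Finset.mem_singleton, Finset.mem_Icc] at hj ⊢
    omega
  have h4 : (branch s.graph B (x (i + 2))).card ≤
      ∑ j ∈ Finset.Icc (n - (k + 2) + 3) n, (branch s.graph B (x (n - j))).card := by
    have e : n - (n - (i + 2)) = i + 2 := by omega
    have := Finset.single_le_sum (f := fun j => (branch s.graph B (x (n - j))).card)
      (s := Finset.Icc (n - (k + 2) + 3) n) (fun _ _ => Nat.zero_le _)
      (Finset.mem_Icc.2 (⟨by omega, by omega⟩ :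
        n - (k + 2) + 3 ≤ n - (i + 2) ∧ n - (i + 2) ≤ n))
    simpa only [e] using this
  have h5 : 0 < (branch s.graph B (x n)).card := card_branch_pos
  omega

/-- The price of a link of a path of vertices of degree two, bounded by the cost of the detour. -/
theorem le_mul_card_branch {H : s.graph.Subgraph} (hH : IsBiconnectedComponent s.graph H)
    (hx : IsTwoPath s.graph H.verts n x) (hα : 0 < α) (hs : IsNashEquilibrium α s)
    (hG : s.graph.Connected) {i : ℕ} (hi : i + 3 ≤ n)
    (hbuy : x (i + 2) ∈ s.links (x (i + 1))) {D : ℕ}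
    (hD : ∀ y ∈ H.verts, s.graph.dist (x (i + 1)) y ≤ D) :
    α ≤ 4 * D * (branch s.graph H.verts (x (i + 2))).card := by
  have hB := hH.pathConvex
  have hu := hx.mem (i + 1) (by omega)
  have hz := hx.mem (i + 2) (by omega)
  have hp := hx.mem i (by omega)
  have huz : s.graph.Adj (x (i + 1)) (x (i + 2)) := hx.adj (by omega)
  have hup := (hx.adj (i := i) (by omega)).symm
  have hpz := hx.ne (i := i) (j := i + 2) (by omega) (by omega)
  have hnbr := hx.eq_or_eq i (by omega)
  have hpz2 := hx.dist_add i (i + 2) (by omega) (by omega)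
  have hzp2 : s.graph.dist (x (i + 2)) (x i) = 2 := by
    rw [dist_comm]
    omega
  have hA := hx.card_farSide_le hα hs hG hB hi hbuy
  obtain ⟨t₀, ht₀, w₀, hw₀, htT, hwT, htu, hwu, htw⟩ := hH.exists_crossing hz hp huz.ne' hup.ne'
    (farSide s.graph (x i) (x (i + 1)) (x (i + 2)) : Set V)
    (by
      rw [Finset.mem_coe, mem_farSide, dist_self, dist_eq_one_iff_adj.2 huz]
      omega)
    (by
      rw [Finset.mem_coe, mem_farSide, hzp2, dist_eq_one_iff_adj.2 hup]
      omega)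
  rw [Finset.mem_coe] at htT hwT
  -- The detour runs to `w₀` outside the far side, crosses the edge to `t₀`, and continues to `x (i
  -- + 2)`; neither distance used grows when the link is deleted.
  have hdetour : ∀ t (ht : x (i + 1) ∉ t), (∀ a ∈ s.links (x (i + 1)), a ≠ x (i + 2) → a ∈ t) →
      (s.update (x (i + 1)) t ht).graph.edist (x (i + 1)) (x (i + 2)) ≤ (2 * D + 1 : ℕ) := by
    intro t ht hsub
    set G' := (s.update (x (i + 1)) t ht).graph
    have hadj : ∀ a b, a ≠ x (i + 1) → b ≠ x (i + 1) → s.graph.Adj a b → G'.Adj a b :=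
      fun a b h1 h2 h => s.update_adj_of_ne ht h1 h2 h
    have h1 : G'.edist (x (i + 1)) w₀ ≤ D :=
      (StrategyVector.update_edist_le_of_notMem_farSide hG hB hu hz huz hup hpz hnbr ht hsub
        hwT).trans (by exact_mod_cast hD w₀ hw₀)
    have h2 : G'.edist (x (i + 2)) t₀ ≤ D := by
      have hd := (mem_farSide.1 htT).1
      have hd' := hD t₀ ht₀
      exact (edist_le_dist_of_avoid hG hadj huz.ne' (by omega)).trans (by exact_mod_cast (by omega))
    rw [SimpleGraph.edist_comm] at h2
    have h3 := edist_le_one_add (hadj w₀ t₀ hwu htu htw.symm) h2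
    refine (G'.edist_triangle (v := w₀)).trans ((add_le_add h1 h3).trans ?_)
    exact_mod_cast (by omega)
  have h := hs.le_mul_card_farSide hα hG hB hu hz hbuy hup hpz hnbr hdetour
  have hA' : ((farSide s.graph (x i) (x (i + 1)) (x (i + 2))).card : ℝ) ≤
      2 * (branch s.graph H.verts (x (i + 2))).card := by exact_mod_cast hA
  push_cast at h
  nlinarith [mul_le_mul_of_nonneg_left hA' (by positivity : (0 : ℝ) ≤ 2 * D)]

/-- In an equilibrium no link in the middle of a long path of vertices of degree two is bought. -/
theorem notMem_links {H : s.graph.Subgraph} (hH : IsBiconnectedComponent s.graph H)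
    (hx : IsTwoPath s.graph H.verts 19 x) (hα : 0 < α) (hs : IsNashEquilibrium α s)
    (hG : s.graph.Connected) : x 10 ∉ s.links (x 9) := by
  intro hbuy
  have hB := hH.pathConvex
  set w : ℕ → ℕ := fun i => (branch s.graph H.verts (x i)).card with hw
  have hbuy' : ∀ k, 11 ≤ k → k ≤ 17 → x (k + 1) ∈ s.links (x k) := fun k h1 h2 =>
    hx.mem_links_of_mem_links hα hs hG hB (i := 8) (by omega) (by omega) hbuy
  have hsum : ∀ i, 10 ≤ i → i ≤ 16 → ∑ j ∈ Finset.Icc (i + 3) 19, w j ≤ w (i + 2) :=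
    fun i h1 h2 => hx.sum_card_branch_le hα hs hG hB (by omega) (hbuy' (i + 1) (by omega) (by omega))
  -- Each weight dominates the sum of all later ones: `w 17 ≥ w 18 + w 19`, and every step back to
  -- `w 12` doubles this bound.
  have h32 : 32 * w 18 ≤ w 12 := by
    have h12 := hsum 10 (by omega) (by omega)
    have h13 := hsum 11 (by omega) (by omega)
    have h14 := hsum 12 (by omega) (by omega)
    have h15 := hsum 13 (by omega) (by omega)
    have h16 := hsum 14 (by omega) (by omega)
    have h17 := hsum 15 (by omega) (by omega)
    norm_num [Finset.sum_Icc_succ_top] at h12 h13 h14 h15 h16 h17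
    omega
  -- Deletion of the link from `x 17` to `x 18` is played against a link bought to `x 12` by a
  -- vertex `y` of `H` farthest from `x 17`.
  obtain ⟨y, hy, hmax⟩ := H.verts.toFinite.exists_maximalFor (fun y => s.graph.dist (x 17) y) _
    ⟨x 0, hx.mem 0 (by omega)⟩
  set D := s.graph.dist (x 17) y with hDdef
  have hD : ∀ v ∈ H.verts, s.graph.dist (x 17) v ≤ D := fun v hv =>
    (le_total _ _).elim id fun h => hmax hv h
  have h1 : α ≤ 4 * D * w 18 :=
    hx.le_mul_card_branch hH hα hs hG (i := 16) (by omega) (hbuy' 17 (by omega) (by omega)) hD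
  have hD17 : 17 ≤ D := by
    have := hx.dist_add 0 17 (by omega) (by omega)
    have := hD _ (hx.mem 0 (by omega))
    rw [dist_comm] at this
    omega
  have hd : D ≤ s.graph.dist y (x 12) + 5 := by
    have h3 := hx.dist_add 12 17 (by omega) (by omega)
    have h4 := hG.dist_triangle (u := x 17) (v := x 12) (w := y)
    rw [dist_comm (u := x 17) (v := x 12), dist_comm (u := x 12) (v := y)] at h4
    omega
  have hne : x 12 ≠ y := by
    intro h
    rw [h, dist_self] at hd
    omega
  have h2 : ((s.graph.dist y (x 12) : ℝ) - 1) * w 12 ≤ α := hs.mul_card_branch_le hα hG hy hne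
  have hw18 : (1 : ℝ) ≤ w 18 := by exact_mod_cast card_branch_pos
  have h32' : 32 * (w 18 : ℝ) ≤ w 12 := by exact_mod_cast h32
  have hd' : (D : ℝ) ≤ s.graph.dist y (x 12) + 5 := by exact_mod_cast hd
  have hD17' : (17 : ℝ) ≤ D := by exact_mod_cast hD17
  have h5 : ((D : ℝ) - 6) * (32 * w 18) ≤ ((s.graph.dist y (x 12) : ℝ) - 1) * w 12 :=
    mul_le_mul (by linarith) h32' (by positivity) (by linarith)
  -- The two bounds on `α` give `32 (D - 6) ≤ 4 D`, so `D < 7`, against `D ≥ 17`.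
  nlinarith [mul_le_mul hD17' hw18 (by norm_num) (by linarith)]

/-- An equilibrium has no long shortest path of vertices of degree two. -/
theorem false {H : s.graph.Subgraph} (hH : IsBiconnectedComponent s.graph H)
    (hx : IsTwoPath s.graph H.verts 19 x) (hα : 0 < α) (hs : IsNashEquilibrium α s)
    (hG : s.graph.Connected) : False :=
  (hx.adj (i := 9) (by omega)).elim (hx.notMem_links hH hα hs hG)
    (hx.reverse.notMem_links hH hα hs hG)

end IsTwoPath

end NetworkCreation

namespace NetworkCreation

open SimpleGraph

/-! ### The average degree of a biconnected component -/

open Classical in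
/-- The neighbours of `v` in `B`. -/
noncomputable def nbrs {V : Type*} (G : SimpleGraph V) (B : Finset V) (v : V) : Finset V :=
  {u ∈ B | G.Adj v u}

theorem mem_nbrs {V : Type*} {G : SimpleGraph V} {B : Finset V} {u v : V} :
    u ∈ nbrs G B v ↔ u ∈ B ∧ G.Adj v u := by
  simp [nbrs]

/-- If every vertex has a shortest path of length at most `k` to a vertex of degree at least three,
along vertices of degree two, then there are many vertices of degree at least three. -/
theorem card_le_of_level {V : Type*} {G : SimpleGraph V} {B : Finset V} {k : ℕ} (h : V → ℕ)
    (hstep : ∀ v ∈ B, ∀ t, h v = t + 1 → ∃ u ∈ B, G.Adj v u ∧ h u = t)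
    (hzero : ∀ v ∈ B, h v = 0 → 3 ≤ (nbrs G B v).card)
    (hpos : ∀ v ∈ B, h v ≠ 0 → (nbrs G B v).card = 2) (hk : ∀ v ∈ B, h v ≤ k) :
    B.card ≤ (3 * k + 1) * ∑ v ∈ B, ((nbrs G B v).card - 2) := by
  classical
  set σ := ∑ v ∈ B, ((nbrs G B v).card - 2)
  let N : ℕ → Finset V := fun t => {v ∈ B | h v = t}
  have hmem : ∀ t v, v ∈ N t ↔ v ∈ B ∧ h v = t := by simp [N]
  have hNσ : ∑ v ∈ N 0, ((nbrs G B v).card - 2) ≤ σ :=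
    Finset.sum_le_sum_of_subset (Finset.filter_subset _ _)
  have h0 : (N 0).card ≤ σ := by
    rw [Finset.card_eq_sum_ones]
    refine (Finset.sum_le_sum fun v hv => ?_).trans hNσ
    have := hzero v ((hmem _ _).1 hv).1 ((hmem _ _).1 hv).2
    omega
  have hcover : ∀ t, N (t + 1) ⊆ (N t).biUnion fun u => {v ∈ nbrs G B u | h v = t + 1} := by
    intro t v hv
    rw [hmem] at hv
    obtain ⟨u, hu, hvu, hut⟩ := hstep v hv.1 t hv.2
    exact Finset.mem_biUnion.2 ⟨u, (hmem _ _).2 ⟨hu, hut⟩,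
      Finset.mem_filter.2 ⟨mem_nbrs.2 ⟨hv.1, hvu.symm⟩, hv.2⟩⟩
  have hN : ∀ t, (N (t + 1)).card ≤ 3 * σ := by
    intro t
    induction t with
    | zero =>
      refine (Finset.card_le_card (hcover 0)).trans (Finset.card_biUnion_le.trans ?_)
      refine le_trans ?_ (Nat.mul_le_mul_left 3 hNσ)
      rw [Finset.mul_sum]
      -- A degree `d ≥ 3` satisfies `d ≤ 3 (d - 2)`.
      refine Finset.sum_le_sum fun v hv => (Finset.card_filter_le _ _).trans ?_
      have := hzero v ((hmem _ _).1 hv).1 ((hmem _ _).1 hv).2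
      omega
    | succ t ih =>
      refine (Finset.card_le_card (hcover (t + 1))).trans (le_trans ?_ ih)
      refine (Finset.card_biUnion_le_card_mul _ _ 1 fun u hu => ?_).trans (by rw [mul_one])
      rw [hmem] at hu
      -- One of the two neighbours of `u` lies a level below, leaving at most one a level above; so
      -- the levels stop growing.
      obtain ⟨a, ha, hua, hat⟩ := hstep u hu.1 t hu.2
      have hsub : {v ∈ nbrs G B u | h v = t + 1 + 1} ⊆ (nbrs G B u).erase a := by
        intro v hv
        rw [Finset.mem_filter] at hv
        refine Finset.mem_erase.2 ⟨?_, hv.1⟩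
        rintro rfl
        omega
      have h1 := Finset.card_le_card hsub
      have h2 := Finset.card_erase_add_one (mem_nbrs.2 ⟨ha, hua⟩)
      have h3 := hpos u hu.1 (by omega)
      omega
  calc B.card = ∑ t ∈ Finset.range (k + 1), (N t).card :=
        Finset.card_eq_sum_card_fiberwise fun v hv => by
          simpa [Nat.lt_succ_iff] using hk v hv
    _ = ∑ t ∈ Finset.range k, (N (t + 1)).card + (N 0).card := Finset.sum_range_succ' _ _
    _ ≤ ∑ _t ∈ Finset.range k, 3 * σ + σ := add_le_add (Finset.sum_le_sum fun t _ => hN t) h0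
    _ = (3 * k + 1) * σ := by simp; ring

theorem PathConvex.card_le {V : Type*} {G : SimpleGraph V} (hG : G.Connected) {B : Finset V}
    (hB : PathConvex G B) {k : ℕ} (hdeg : ∀ v ∈ B, 2 ≤ (nbrs G B v).card)
    (hk : ∀ v ∈ B, ∃ c ∈ B, 3 ≤ (nbrs G B c).card ∧ G.dist v c ≤ k) :
    B.card ≤ (3 * k + 1) * ∑ v ∈ B, ((nbrs G B v).card - 2) := by
  -- Distance to the nearest vertex of degree at least three; `hk` makes the set non-empty on `B`,
  -- so the default `0` of `sInf` never intervenes there.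
  let h : V → ℕ := fun v => sInf {t | ∃ c ∈ B, 3 ≤ (nbrs G B c).card ∧ G.dist v c = t}
  have hle : ∀ v, ∀ c ∈ B, 3 ≤ (nbrs G B c).card → h v ≤ G.dist v c :=
    fun v c hc h3 => Nat.sInf_le ⟨c, hc, h3, rfl⟩
  have hex : ∀ v ∈ B, ∃ c ∈ B, 3 ≤ (nbrs G B c).card ∧ G.dist v c = h v := by
    intro v hv
    obtain ⟨c, hc, h3, -⟩ := hk v hv
    exact Nat.sInf_mem (s := {t | ∃ c ∈ B, 3 ≤ (nbrs G B c).card ∧ G.dist v c = t})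
      ⟨_, c, hc, h3, rfl⟩
  refine card_le_of_level h ?_ ?_ ?_ ?_
  · intro v hv t ht
    obtain ⟨c, hc, h3, hd⟩ := hex v hv
    have hvc : v ≠ c := by
      rintro rfl
      rw [dist_self] at hd
      omega
    obtain ⟨a, ha, hva, had⟩ := hB.exists_adj_dist_add_one hG hv hc hvc
    refine ⟨a, ha, hva, ?_⟩
    have h1 := hle a c hc h3
    obtain ⟨c', hc', h3', hd'⟩ := hex a ha
    have h2 := hle v c' hc' h3'
    have h4 := hG.dist_triangle (u := v) (v := a) (w := c')
    rw [dist_eq_one_iff_adj.2 hva] at h4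
    omega
  · intro v hv h0
    obtain ⟨c, hc, h3, hd⟩ := hex v hv
    rw [h0, hG.dist_eq_zero_iff] at hd
    rwa [hd]
  · intro v hv h0
    by_contra hne
    have h1 := hle v v hv (by have := hdeg v hv; omega)
    rw [dist_self] at h1
    omega
  · intro v hv
    obtain ⟨c, hc, h3, hd⟩ := hk v hv
    exact (hle v c hc h3).trans hd

theorem dist_getVert_add {V : Type*} {G : SimpleGraph V} (hG : G.Connected) {a b : V}
    (p : G.Walk a b) (hp : p.length = G.dist a b) {i j : ℕ} (hij : i ≤ j) (hj : j ≤ p.length) :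
    G.dist (p.getVert i) (p.getVert j) + i = j := by
  have hlip : ∀ i k, i + k ≤ p.length → G.dist (p.getVert i) (p.getVert (i + k)) ≤ k := by
    intro i k
    induction k with
    | zero => simp
    | succ k ih =>
      intro hk
      have h1 := ih (by omega)
      have h2 := dist_eq_one_iff_adj.2 (p.adj_getVert_succ (i := i + k) (by omega))
      have h3 := hG.dist_triangle (u := p.getVert i) (v := p.getVert (i + k))
        (w := p.getVert (i + k + 1))
      rw [← add_assoc]
      omega
  have h1 := hlip 0 i (by omega)
  have h2 := hlip i (j - i) (by omega)
  have h3 := hlip j (p.length - j) (by omega)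
  rw [zero_add, Walk.getVert_zero] at h1
  rw [show i + (j - i) = j by omega] at h2
  rw [show j + (p.length - j) = p.length by omega, Walk.getVert_length] at h3
  have h4 := hG.dist_triangle (u := a) (v := p.getVert i) (w := b)
  have h5 := hG.dist_triangle (u := p.getVert i) (v := p.getVert j) (w := b)
  omega

/-- Shortest paths of `G` between vertices of `H` stay in `H`, so the diameter hypothesis on `H`
yields large distances in `G`. -/
theorem IsBiconnectedComponent.coe_dist_le {V : Type*} {G : SimpleGraph V} (hG : G.Connected)
    {H : G.Subgraph} (hH : IsBiconnectedComponent G H) (a b : H.verts) :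
    H.coe.dist a b ≤ G.dist a b := by
  suffices H.coe.edist a b ≤ (G.dist a b : ℕ) from ENat.toNat_le_of_le_natCast this
  induction hn : G.dist (a : V) b generalizing a with
  | zero =>
    rw [hG.dist_eq_zero_iff] at hn
    simp [Subtype.ext hn]
  | succ n ih =>
    have hab : (a : V) ≠ b := by
      intro h
      rw [h, dist_self] at hn
      omega
    obtain ⟨c, hc, hac, hd⟩ := hH.pathConvex.exists_adj_dist_add_one hG a.2 b.2 hab
    exact edist_le_one_add (a := ⟨c, hc⟩) (hH.adj_of_mem a.2 hc hac) (ih ⟨c, hc⟩ (by change G.dist c b = n; omega))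

/-- If both ends of a diametral pair were within `n - 1` of `v`, the diameter would be at most `2 n
- 2`. -/
theorem IsBiconnectedComponent.exists_le_dist {V : Type*} [Finite V] {G : SimpleGraph V}
    (hG : G.Connected) {H : G.Subgraph} (hH : IsBiconnectedComponent G H) {n : ℕ}
    (hdiam : 2 * n ≤ H.coe.diam + 1) (v : V) (hv : v ∈ H.verts) : ∃ y ∈ H.verts, n ≤ G.dist v y := by
  have : Nonempty H.verts := ⟨⟨v, hv⟩⟩
  obtain ⟨a, b, hab⟩ := H.coe.exists_dist_eq_diam
  have h1 := hH.coe_dist_le hG a b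
  have h2 := hG.dist_triangle (u := (a : V)) (v := v) (w := b)
  rw [dist_comm (u := (a : V)) (v := v)] at h2
  by_cases ha : n ≤ G.dist v a
  · exact ⟨a, a.2, ha⟩
  · exact ⟨b, b.2, by omega⟩

theorem IsNontrivialBiconnectedComponent.two_le_card_nbrs {V : Type*} {G : SimpleGraph V}
    {H : G.Subgraph} (hH : IsNontrivialBiconnectedComponent G H) {B : Finset V}
    (hB : ∀ v, v ∈ B ↔ v ∈ H.verts) {v : V} (hv : v ∈ H.verts) : 2 ≤ (nbrs G B v).card := by
  obtain ⟨hH, h3⟩ := hH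
  have hex : ∀ z, ∃ u ∈ H.verts, u ≠ v ∧ u ≠ z := by
    intro z
    by_contra! hcon
    have hsub : H.verts ⊆ {v, z} := fun u hu => by
      by_cases huv : u = v
      · simp [huv]
      · simp [hcon u hu huv]
    have h := h3.trans ((Set.encard_le_encard hsub).trans (Set.encard_insert_le _ _))
    rw [Set.encard_singleton] at h
    norm_num at h
  -- If `z` were the only neighbour of `v` in `H`, deleting `z` would cut `v` off from a third
  -- vertex.
  have hnbr : ∀ z ≠ v, ∃ u ∈ H.verts, G.Adj v u ∧ u ≠ z := by
    intro z hz
    obtain ⟨c, hc, hcv, hcz⟩ := hex z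
    obtain ⟨t, -, u, hu, ht, -, -, huz, htu⟩ :=
      hH.exists_crossing hv hc hz.symm hcz {v} rfl hcv
    rw [Set.mem_singleton_iff] at ht
    exact ⟨u, hu, ht ▸ htu, huz⟩
  obtain ⟨b, -, hbv, -⟩ := hex v
  obtain ⟨c, hc, hvc, -⟩ := hnbr b hbv
  obtain ⟨d, hd, hvd, hdc⟩ := hnbr c hvc.ne'
  exact Finset.one_lt_card.2
    ⟨c, mem_nbrs.2 ⟨(hB c).2 hc, hvc⟩, d, mem_nbrs.2 ⟨(hB d).2 hd, hvd⟩, hdc.symm⟩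

/-- In an equilibrium every vertex of a biconnected component of large diameter is close to a vertex
of degree at least three. -/
theorem IsNashEquilibrium.exists_three_le_card_nbrs {V : Type*} [Fintype V] {α : ℝ} (hα : 0 < α)
    {s : StrategyVector V} (hs : IsNashEquilibrium α s) (hG : s.graph.Connected)
    {H : s.graph.Subgraph} (hH : IsBiconnectedComponent s.graph H) (hdiam : 37 ≤ H.coe.diam)
    {B : Finset V} (hB : ∀ v, v ∈ B ↔ v ∈ H.verts) {v : V} (hv : v ∈ H.verts) :
    ∃ c ∈ H.verts, 3 ≤ (nbrs s.graph B c).card ∧ s.graph.dist v c ≤ 18 := by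
  classical
  by_contra! hcon
  obtain ⟨y, hy, hvy⟩ := hH.exists_le_dist hG (n := 19) (by omega) v hv
  obtain ⟨p, hpath, hp⟩ := hG.exists_path_of_dist v y
  have hmem : ∀ i, p.getVert i ∈ H.verts := fun i =>
    hH.pathConvex hv hy p hpath _ (p.getVert_mem_support i)
  have hdist : ∀ i j, i ≤ j → j ≤ 19 → s.graph.dist (p.getVert i) (p.getVert j) + i = j :=
    fun i j hij hj => dist_getVert_add hG p hp hij (by omega)
  refine IsTwoPath.false (x := p.getVert) hH ⟨fun i _ => hmem i, hdist, ?_⟩ hα hs hG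
  intro i hi a ha hadj
  by_contra! hne
  have h1 := (p.adj_getVert_succ (i := i) (by omega)).symm
  have h2 := p.adj_getVert_succ (i := i + 1) (by omega)
  have h12 : p.getVert i ≠ p.getVert (i + 2) := by
    intro h
    have := hdist i (i + 2) (by omega) hi
    rw [h, dist_self] at this
    omega
  have hsub : ({a, p.getVert i, p.getVert (i + 2)} : Finset V) ⊆
      nbrs s.graph B (p.getVert (i + 1)) := by
    intro b hb
    simp only [Finset.mem_insert, Finset.mem_singleton] at hb
    rw [mem_nbrs, hB]
    obtain rfl | rfl | rfl := hb
    · exact ⟨ha, hadj⟩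
    · exact ⟨hmem _, h1⟩
    · exact ⟨hmem _, h2⟩
  have h3 := Finset.card_le_card hsub
  rw [Finset.card_eq_three.2 ⟨_, _, _, hne.1, hne.2, h12, rfl⟩] at h3
  have h4 := hcon _ (hmem (i + 1)) h3
  have h5 := hdist 0 (i + 1) (by omega) (by omega)
  rw [Walk.getVert_zero] at h5
  omega

open Classical in
-- Every edge is bought by at least one end. Only an inequality is claimed, since both ends may buy
-- it.
theorem sum_card_nbrs_le {V : Type*} (s : StrategyVector V) (H : s.graph.Subgraph) {B : Finset V}
    (hB : ∀ v, v ∈ B ↔ v ∈ H.verts) :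
    ∑ v ∈ B, (nbrs s.graph B v).card ≤ 2 * ∑ v ∈ B, outDegree s H v := by
  have hout : ∀ v, outDegree s H v = (B.bipartiteAbove (fun v u => u ∈ s.links v) v).card := by
    intro v
    rw [outDegree, ← Set.ncard_coe_finset]
    congr 1
    ext u
    simp [Finset.bipartiteAbove, hB]
  have hdouble := Finset.sum_card_bipartiteAbove_eq_sum_card_bipartiteBelow (s := B) (t := B)
    (fun v u => u ∈ s.links v)
  simp_rw [hout]
  rw [two_mul]
  nth_rewrite 2 [hdouble]
  rw [← Finset.sum_add_distrib]
  refine Finset.sum_le_sum fun v _ => le_trans (Finset.card_le_card ?_) (Finset.card_union_le _ _)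
  intro u hu
  obtain ⟨huB, h⟩ := mem_nbrs.1 hu
  rw [Finset.mem_union, Finset.mem_bipartiteAbove, Finset.mem_bipartiteBelow]
  exact h.imp (fun h => ⟨huB, h⟩) (fun h => ⟨huB, h⟩)

end NetworkCreation

theorem mainTheorem5 {V : Type*} [Fintype V] (α : ℝ) (hα : 0 < α)
    (s : NetworkCreation.StrategyVector V) (hs : NetworkCreation.IsNashEquilibrium α s)
    (H : s.graph.Subgraph) (hH : NetworkCreation.IsNontrivialBiconnectedComponent s.graph H)
    (hdiam : 37 ≤ H.coe.diam) :
    NetworkCreation.avgOutDegree s H ≥ 1 + 1 / 221 := by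
  classical
  set B : Finset V := {v | v ∈ H.verts} with hBdef
  have hB : ∀ v, v ∈ B ↔ v ∈ H.verts := by simp [hBdef]
  have hBcoe : (B : Set V) = H.verts := Set.ext hB
  obtain ⟨v₀, hv₀⟩ : H.verts.Nonempty := by
    rw [← Set.encard_pos]
    exact lt_of_lt_of_le (by norm_num) hH.2
  have : Nonempty V := ⟨v₀⟩
  have hG := hs.connected
  have hdeg : ∀ v ∈ B, 2 ≤ (NetworkCreation.nbrs s.graph B v).card :=
    fun v hv => hH.two_le_card_nbrs hB ((hB v).1 hv)
  have hcard : B.card ≤ (3 * 18 + 1) * ∑ v ∈ B, ((NetworkCreation.nbrs s.graph B v).card - 2) := by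
    refine NetworkCreation.PathConvex.card_le hG (hBcoe ▸ hH.1.pathConvex) hdeg fun v hv => ?_
    obtain ⟨c, hc, h⟩ := hs.exists_three_le_card_nbrs hα hG hH.1 hdiam hB ((hB v).1 hv)
    exact ⟨c, (hB c).2 hc, h⟩
  have hsum : ∑ v ∈ B, ((NetworkCreation.nbrs s.graph B v).card - 2) + 2 * B.card =
      ∑ v ∈ B, (NetworkCreation.nbrs s.graph B v).card := by
    rw [mul_comm, ← smul_eq_mul, ← Finset.sum_const, ← Finset.sum_add_distrib]
    exact Finset.sum_congr rfl fun v hv => Nat.sub_add_cancel (hdeg v hv)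
  have hout := NetworkCreation.sum_card_nbrs_le s H hB
  have hpos : (0 : ℝ) < B.card := by
    exact_mod_cast Finset.card_pos.2 ⟨v₀, (hB v₀).2 hv₀⟩
  -- With `σ` the degree excess, `2 |B| + σ ≤ 2 ∑ deg⁺` and `|B| ≤ 55 σ` even give the ratio `111 /
  -- 110`, which exceeds `222 / 221`.
  have key : 222 * B.card ≤ 221 * ∑ v ∈ B, NetworkCreation.outDegree s H v := by omega
  rw [NetworkCreation.avgOutDegree, ← hBcoe, Set.ncard_coe_finset, ge_iff_le, le_div_iff₀ hpos]
  have key' : (222 : ℝ) * B.card ≤ 221 * ∑ v ∈ B, (NetworkCreation.outDegree s H v : ℝ) := by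
    exact_mod_cast key
  calc (1 + 1 / 221) * (B.card : ℝ) ≤ ∑ v ∈ B, (NetworkCreation.outDegree s H v : ℝ) := by linarith
    _ = _ := Finset.sum_congr (by ext v; simp) fun _ _ => rfl
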